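/- Let $I=[-1,1]$ and, for $s\in(0,2]$, let $T_s\colon I\to I$, $T_s(x)=s(1-|x|)-1$, be the tent map with turning point $0$. Its kneading invariant $e_1e_2e_3\ldots\in\{0,1\}^{\mathbb N}$ is defined as follows: $e_j$ is the constant value, for all $y>0$ close enough to $0$, of the symbol which is $0$ if $T_s^j(y)<0$ and $1$ if $T_s^j(y)>0$. Say that $T_s$ has Fibonacci recurrence if its kneading map is $Q(k)=\max\{0,k-2\}$, that is, if $e_1=1$ and, with $S(0)=1$ and $S(k)=S(k-1)+S(Q(k))$ for $k\ge1$, $$e_{S(k-1)+1}\cdots e_{S(k)}=e_1\cdots e_{S(Q(k))-1}\,(1-e_{S(Q(k))})\qquad\text{for every }k\ge 1 .$$ Let $\lambda\in(0,2]$ be such that $T=T_\lambda$ has Fibonacci recurrence. Let $h\colon I\to I$ be a homeomorphism, real analytic on $I\setminus\{0\}$, whose only critical point (zero of $h'$) is $0$, and suppose that this critical point is non-flat with right order $\alpha^+>0$ and left order $\alpha^->0$: there are $M,\delta>0$ such that $\bigl|\log\bigl(|h'(x)|/|x|^{\alpha^+}\bigr)\bigr|\le M$ for $x\in(0,\delta)$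 and $\bigl|\log\bigl(|h'(x)|/|x|^{\alpha^-}\bigr)\bigr|\le M$ for $x\in(-\delta,0)$. Put $\alpha=\max\{\alpha^+,\alpha^-\}$, $\varphi=\frac{1+\sqrt5}{2}$, $f=h\circ T\circ h^{-1}$, $\tilde c=h(0)$, $\mathcal O_f(x)=\{f^n(x):n\ge0\}$, and $\mathcal S(f)=\{x\in I: f'(x)=0\}\cup\{\tilde c\}$. Then for every $x\in\overline{\mathcal O_f(\tilde c)}$ the following holds. (a) If $\tilde c\notin\mathcal O_f(x)$, then for every $n\ge0$ the derivative $(f^n)'(x)$ exists and is nonzero, and $$\liminf_{n\to\infty}\frac1n\log|(f^n)'(x)|\le\Bigl(1-\frac{\alpha}{\varphi}\Bigr)\log\lambda<\log\lambda\le\limsup_{n\to\infty}\frac1n\log|(f^n)'(x)|,$$ where the lower and upper limits are taken in $[-\infty,+\infty]$. Hence the pointwise Lyapunov exponent $\lim_{n\to\infty}\frac1n\log|(f^n)'(x)|$ does not exist, not even as an element of $[-\infty,+\infty]$. (b) If $\mathcal O_f(x)\cap\mathcal S(f)\ne\emptyset$, then for all sufficiently large $n$ the map $f^n$ is not differentiable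 at $x$, so that the pointwise Lyapunov exponent of $f$ at $x$ is not defined. -/

import Mathlib

open Filter Topology

noncomputable section

namespace LorenzFib

/-- The interval `[-1,1]` on which all maps act. -/
abbrev J : Type := Set.Icc (-1 : ℝ) 1

/-- The point `0` of `[-1,1]`. -/
def zeroJ : J := ⟨0, by norm_num⟩

/-- A self-map of `[-1,1]` as a real function; only its values on `[-1,1]` are ever used. -/
def realExt (g : J → J) : ℝ → ℝ :=
  Set.IccExtend (by norm_num : (-1 : ℝ) ≤ 1) (fun x => (g x : ℝ))

/-- `g` is differentiable at `x ∈ [-1,1]` with derivative `d` (one-sided at the end points). -/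
def HasDerivJ (g : J → J) (d : ℝ) (x : J) : Prop :=
  HasDerivWithinAt (realExt g) d (Set.Icc (-1 : ℝ) 1) (x : ℝ)

/-- The derivative `g'(x)`; meaningful when `g` is differentiable at `x`. -/
def derivJ (g : J → J) (x : J) : ℝ :=
  derivWithin (realExt g) (Set.Icc (-1 : ℝ) 1) (x : ℝ)

/-- The set `Crit(g)` of the points where the derivative exists and vanishes. -/
def critSet (g : J → J) : Set J := {x | HasDerivJ g 0 x}

/-- `S(g) = Crit(g) ∪ {c}`, for a map with turning point `c`. -/
def singularSet (g : J → J) (c : J) : Set J := critSet g ∪ {c}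

/-- The orbit `{gⁿ(x) : n ≥ 0}`. -/
def orbit (g : J → J) (x : J) : Set J := Set.range (fun n : ℕ => g^[n] x)

/-- `p` is a non-flat critical point of `g` with right order `ap` and left order `am`. The
derivative is required to exist and not to vanish where its logarithm is taken. -/
structure IsNonflatCritical (g : J → J) (p : J) (ap am : ℝ) : Prop where
  crit : p ∈ critSet g
  right_pos : 0 < ap
  left_pos : 0 < am
  bound : ∃ M > 0, ∃ δ > 0,
    (∀ x : J, (p : ℝ) < x → (x : ℝ) < p + δ →
      ∃ d : ℝ, d ≠ 0 ∧ HasDerivJ g d x ∧ |Real.log (|d| / |(x : ℝ) - p| ^ ap)| ≤ M) ∧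
    (∀ x : J, (p : ℝ) - δ < x → (x : ℝ) < p →
      ∃ d : ℝ, d ≠ 0 ∧ HasDerivJ g d x ∧ |Real.log (|d| / |(x : ℝ) - p| ^ am)| ≤ M)

/-- The `n`-th letter of the itinerary of `x` under `g` with respect to the turning point `c`:
`some false` is the letter `0` (left of `c`), `some true` the letter `1` (right of `c`), and
`none` the letter `c`. -/
def itinerary (g : J → J) (c x : J) (n : ℕ) : Option Bool :=
  if g^[n] x < c then some false else if c < g^[n] x then some true else none

/-- `e` is the limit of the itineraries of `y` as `y` decreases to `c`, for the product topology
(letter by letter). Its letters `e 1, e 2, …` form the kneading invariant of `g`. -/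
def IsKneadingInvariant (g : J → J) (c : J) (e : ℕ → Bool) : Prop :=
  ∀ j : ℕ, ∀ᶠ y in 𝓝[>] c, itinerary g c y j = some (e j)

/-- The kneading invariant of `g` is the one that the kneading map `Q` defines: with
`S 0 = 1` and `S k = S (k-1) + S (Q k)`, one has `e 1 = 1` and, for every `k ≥ 1`,
`e (S(k-1)+1) ⋯ e (S k) = e 1 ⋯ e (S(Q k) - 1) (1 - e (S(Q k)))`. -/
def HasKneadingMap (g : J → J) (c : J) (Q : ℕ → ℕ) : Prop :=
  (∀ k, 1 ≤ k → Q k < k) ∧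
  ∃ (e : ℕ → Bool) (S : ℕ → ℕ), IsKneadingInvariant g c e ∧
    S 0 = 1 ∧ (∀ k, 1 ≤ k → S k = S (k - 1) + S (Q k)) ∧
    e 1 = true ∧
    ∀ k, 1 ≤ k →
      (∀ i, 1 ≤ i → i < S (Q k) → e (S (k - 1) + i) = e i) ∧
      e (S (k - 1) + S (Q k)) = !(e (S (Q k)))

/-- Fibonacci recurrence: the kneading map is `Q k = max (0, k - 2)` (truncated subtraction). -/
def HasFibonacciRecurrence (g : J → J) (c : J) : Prop :=
  HasKneadingMap g c (fun k => k - 2)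

/-- The tent map `T_s(x) = s (1 - |x|) - 1` on `[-1,1]`, for `s ∈ (0,2]`. -/
def tentMap (s : ℝ) (hs : s ∈ Set.Ioc (0 : ℝ) 2) : J → J := fun x =>
  ⟨s * (1 - |(x : ℝ)|) - 1, by
    have h1 : |(x : ℝ)| ≤ 1 := abs_le.mpr ⟨x.2.1, x.2.2⟩
    have h2 := abs_nonneg (x : ℝ)
    have h3 := hs.1
    have h4 := hs.2
    constructor <;> nlinarith⟩

/-- The finite-time exponents `(1/n) log |(gⁿ)'(x)|`, as extended reals. -/
def lyapSeq (g : J → J) (x : J) (n : ℕ) : EReal :=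
  (((1 / (n : ℝ)) * Real.log |derivJ (g^[n]) x| : ℝ) : EReal)

end LorenzFib

end

open LorenzFib

/-!
Write `T` for the tent map of slope `s = lam` and `x = h y`. Since `fⁿ = h ∘ Tⁿ ∘ h⁻¹`, the chain
rule gives `log |(fⁿ)'(x)| = n log s + log |h'(Tⁿ y)| - log |h'(y)|` as long as the orbit of `y`
avoids the turning point `0` (`hasDerivJ_iterate_conj`). So the finite-time exponents are governed
by the approaches of `Tⁿ y` to `0`, where `log |h'(z)|` is `α log |z|` up to a constant.

*Upper limit.* A point close to `0` is mapped close to `s - 1 > 0`, so at least one of two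
consecutive points of the orbit is far from `0`, where `log |h'|` is bounded
(`frequently_lt_average`).

*Lower limit.* Let `c n = Tⁿ 0` and let `S k = Nat.fib (k + 2)` be the cutting times. The letter
`e n` is the side of `0` on which `c n` lies, and as long as the letters agree, `T` multiplies
distances by `s`; so `|c (M + n) - c n| = s ^ n * |c M|` when `e (M + i) = e i` for `0 < i < n`. If
the Zeckendorf representation of `M` has no digit below `k` (`FibSparse k M`), such an agreement
holds up to the length `S (k - 1)`, and induction on `k` yields
`|c M| ≤ 2 ^ k * s ^ (2 - S (k + 1))` (`IsFibonacciTent.abs_le_of_fibSparse`). From any `m`, a number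
without digits below `k` is reached in fewer than `S k` steps. The approach has to take place on
the side where `h` has the larger order `α`; that side is determined by the lowest digit `j`
through `e (S j)`, which has period four in `j`. Choosing `k` with `e (S k) = e (S (k + 1))` the
desired side, either `j` is good, or `j ≥ k + 2` and adding `S k` makes `k` the lowest digit; in
all, at most `2 * S k` steps (`IsFibonacciTent.exists_close`). This passes to the closure of the
critical orbit, and since `S (k + 1) / (2 * S k)` tends to `φ / 2 > 1 / φ`, the lower limit is at
most `(1 - α / φ) log s` (`IsFibonacciTent.frequently_average_le`).

*Orbits through the singular set.* A critical point of `f` other than `h 0` is mapped to `h 0` by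
`f`. If `Tᵐ y = 0`, then for `n > m` the map `Tⁿ` is `z ↦ Tⁿ y + a * |z - y|` near `y`, with
`a ≠ 0`. Moreover `Tⁿ y ≠ 0`: if `0` were periodic, so would be the kneading sequence
(`IsFibonacciWord.not_periodic`). Hence `fⁿ ∘ h = h ∘ Tⁿ` has at `y` two different one-sided
derivatives, while `h` is differentiable at `y` (`not_hasDerivJ_iterate_conj`).
-/

namespace LorenzFib

/-! ### Fibonacci kneading sequences -/

/-- The properties of the letters `e 1, e 2, …` defined by the kneading map `Q k = max (0, k - 2)`
that the proof uses. The cutting times are `S k = Nat.fib (k + 2)`. -/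
structure IsFibonacciWord (e : ℕ → Bool) : Prop where
  one : e 1 = true
  two : e 2 = false
  copy : ∀ k i, 0 < i → i < Nat.fib (k + 1) → e (Nat.fib (k + 2) + i) = e i
  flip : ∀ k, e (Nat.fib (k + 4)) = !e (Nat.fib (k + 2))

lemma eq_fib_of_recurrence {S : ℕ → ℕ} (h0 : S 0 = 1)
    (hS : ∀ k, 1 ≤ k → S k = S (k - 1) + S (k - 2)) (k : ℕ) : S k = Nat.fib (k + 2) := by
  induction k using Nat.strong_induction_on with
  | _ k ih =>
    match k with
    | 0 => simpa using h0
    | 1 => rw [hS 1 le_rfl]; simp [h0]; rfl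
    | k + 2 =>
      rw [hS (k + 2) (by omega), ih (k + 2 - 1) (by omega), ih (k + 2 - 2) (by omega)]
      simp only [Nat.add_sub_cancel, show k + 2 - 1 + 2 = k + 3 by omega]
      rw [Nat.fib_add_two (n := k + 2)]
      ring

lemma HasFibonacciRecurrence.exists_word {g : J → J} {c : J} (hg : HasFibonacciRecurrence g c) :
    ∃ e, IsKneadingInvariant g c e ∧ IsFibonacciWord e := by
  obtain ⟨-, e, S, he, h0, hS, h1, hc⟩ := hg
  have hfib := eq_fib_of_recurrence h0 hS
  simp only [hfib] at hc
  refine ⟨e, he, h1, ?_, ?_, ?_⟩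
  · have := (hc 1 le_rfl).2
    simpa [h1] using this
  · intro k i hi hik
    rcases k with _ | k
    · simp at hik; omega
    · have := (hc (k + 2) (by omega)).1 i hi (by simpa using hik)
      simpa using this
  · intro k
    have := (hc (k + 2) (by omega)).2
    simp only [Nat.add_sub_cancel, show k + 2 - 1 + 2 = k + 3 by omega] at this
    rw [← this, Nat.fib_add_two (n := k + 2), add_comm]

namespace IsFibonacciWord

variable {e : ℕ → Bool}

/-- A Fibonacci word is not periodic: a period `p` would force every cutting time `S k` exceeding
it to be a period too, and this fails at the place where the letter is flipped. -/
lemma not_periodic (he : IsFibonacciWord e) {p : ℕ} (hp : 0 < p) :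
    ¬ ∀ j, 0 < j → e (p + j) = e j := by
  intro hper
  have hlarge : p + 1 < Nat.fib (p + 6 + 1) :=
    lt_of_lt_of_le (by omega) (Nat.le_fib_self (by omega))
  have hS : ∀ j, 0 < j → e (Nat.fib (p + 6 + 2) + j) = e j := by
    intro j
    induction j using Nat.strong_induction_on with
    | _ j ih =>
      intro hj
      by_cases hlt : j < Nat.fib (p + 6 + 1)
      · exact he.copy _ j hj hlt
      · have h1 := hper (j - p) (by omega)
        have h2 := hper (Nat.fib (p + 6 + 2) + (j - p)) (by omega)
        have h3 := ih (j - p) (by omega) (by omega)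
        rw [show p + (j - p) = j by omega] at h1
        rw [show p + (Nat.fib (p + 6 + 2) + (j - p)) = Nat.fib (p + 6 + 2) + j by omega] at h2
        rw [h2, h3, h1]
  have h1 := hS (Nat.fib (p + 5 + 2)) (Nat.fib_pos.2 (by omega))
  have h2 := he.flip (p + 5)
  rw [show p + 5 + 4 = p + 6 + 1 + 2 by omega, Nat.fib_add_two,
    show p + 6 + 1 + 1 = p + 6 + 2 by omega, add_comm] at h2
  rw [h2] at h1
  revert h1
  cases e (Nat.fib (p + 5 + 2)) <;> simp

/-- The letters at the cutting times have the pattern `1, 0, 0, 1` of period four. Hence each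
letter occurs at two consecutive cutting times, arbitrarily far out. -/
lemma exists_pair (he : IsFibonacciWord e) (b : Bool) (K : ℕ) :
    ∃ k ≥ K, e (Nat.fib (k + 2)) = b ∧ e (Nat.fib (k + 3)) = b := by
  have key : ∀ k, e (Nat.fib (4 * k + 2)) = true ∧ e (Nat.fib (4 * k + 3)) = false := by
    intro k
    induction k with
    | zero => exact ⟨by simpa using he.one, by simpa [Nat.fib] using he.two⟩
    | succ k ih =>
      have h1 := he.flip (4 * k)
      have h2 := he.flip (4 * k + 1)
      have h3 := he.flip (4 * k + 2)
      have h4 := he.flip (4 * k + 3)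
      rw [show 4 * (k + 1) + 2 = 4 * k + 2 + 4 by ring, show 4 * (k + 1) + 3 = 4 * k + 3 + 4 by ring,
        h3, h4]
      simp only [add_assoc, Nat.reduceAdd] at *
      rw [h1, h2, ih.1, ih.2]
      simp
  cases b with
  | false =>
    refine ⟨4 * K + 1, by omega, (key K).2, ?_⟩
    rw [show 4 * K + 1 + 3 = 4 * K + 4 by ring, he.flip, (key K).1]
    rfl
  | true =>
    refine ⟨4 * K + 3, by omega, ?_, ?_⟩
    · rw [show 4 * K + 3 + 2 = 4 * K + 1 + 4 by ring, he.flip, (key K).2]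
      rfl
    · exact (key (K + 1)).1

end IsFibonacciWord

/-! ### Sparse sums of Fibonacci numbers -/

/-- `FibSparse k N` says that `N` is a sum of cutting times `S j = Nat.fib (j + 2)` with indices
`j ≥ k`, no two of them equal or consecutive (the Zeckendorf representation of `N`, with vanishing
digits below `k`). -/
inductive FibSparse : ℕ → ℕ → Prop
  | zero (k : ℕ) : FibSparse k 0
  | add {k j M : ℕ} : k ≤ j → FibSparse (j + 2) M → FibSparse k (Nat.fib (j + 2) + M)

namespace FibSparse

lemma mono {k l N : ℕ} (h : FibSparse l N) (hkl : k ≤ l) : FibSparse k N := by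
  cases h with
  | zero => exact .zero k
  | add hj hM => exact .add (hkl.trans hj) hM

lemma fib (k : ℕ) : FibSparse k (Nat.fib (k + 2)) := .add le_rfl (.zero _)

/-- Carrying: adding a cutting time just below the lowest one allowed. -/
lemma carry {l N : ℕ} (h : FibSparse l N) :
    ∀ j, l = j + 1 → FibSparse j (Nat.fib (j + 2) + N) := by
  induction h with
  | zero l => exact fun j _ => fib j
  | @add l i M hi hM ih =>
    rintro j rfl
    rcases hi.eq_or_lt with rfl | hlt
    · have h := (ih (j + 2) rfl).mono (show j ≤ j + 2 by omega)
      rw [show j + 1 + 2 = j + 3 by ring] at *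
      rw [← add_assoc, ← Nat.fib_add_two]
      exact h
    · exact .add le_rfl (.add hlt hM)

/-- Starting from a sparse sum, the lowest index can be raised by adding one cutting time. -/
lemma raise {k N : ℕ} (h : FibSparse k N) :
    FibSparse (k + 1) N ∨ FibSparse (k + 1) (Nat.fib (k + 1) + N) := by
  cases h with
  | zero => exact .inl (.zero _)
  | @add _ j M hj hM =>
    rcases hj.eq_or_lt with rfl | hlt
    · right
      rw [← add_assoc, ← Nat.fib_add_two]
      exact carry hM (k + 1) rfl
    · exact .inl (.add hlt hM)

lemma of_nat (N : ℕ) : FibSparse 0 N := by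
  induction N with
  | zero => exact .zero 0
  | succ N ih =>
    rcases raise ih with h | h
    · simpa [add_comm] using carry h 0 rfl
    · simpa [add_comm] using h.mono (Nat.zero_le 1)

/-- Every number becomes a sum with vanishing digits below `k` after at most `S k - 1` steps. -/
lemma exists_add (k m : ℕ) : ∃ n < Nat.fib (k + 2), FibSparse k (m + n) := by
  induction k with
  | zero => exact ⟨0, by simp, of_nat m⟩
  | succ k ih =>
    obtain ⟨n, hn, h⟩ := ih
    have hfib : Nat.fib (k + 1 + 2) = Nat.fib (k + 1) + Nat.fib (k + 2) := Nat.fib_add_two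
    rcases raise h with h | h
    · exact ⟨n, by omega, h⟩
    · exact ⟨n + Nat.fib (k + 1), by omega, by convert h using 1; ring⟩

end FibSparse

/-- Translation by a sparse sum does not change the letters up to the length `S (k - 1)`. -/
lemma IsFibonacciWord.shift {e : ℕ → Bool} (he : IsFibonacciWord e) {k M : ℕ}
    (h : FibSparse k M) : ∀ i, 0 < i → i < Nat.fib (k + 1) → e (M + i) = e i := by
  induction h with
  | zero => intro i _ _; rw [zero_add]
  | @add k j M hj hM ih =>
    intro i hi hik
    have hij : i < Nat.fib (j + 1) := hik.trans_le (Nat.fib_mono (by omega))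
    have hfib : Nat.fib (j + 2 + 1) = Nat.fib (j + 1) + Nat.fib (j + 2) := Nat.fib_add_two
    rw [show Nat.fib (j + 2) + M + i = M + (Nat.fib (j + 2) + i) by ring,
      ih _ (by omega) (by omega), he.copy j i hi hij]

/-! ### The tent map on the real line -/

/-- The formula of the tent map of slope `s` on the whole real line. -/
def tent (s x : ℝ) : ℝ := s * (1 - |x|) - 1

lemma continuous_tent (s : ℝ) : Continuous (tent s) := by
  unfold tent; fun_prop

lemma coe_tentMap_iterate {s : ℝ} (hs : s ∈ Set.Ioc (0 : ℝ) 2) (n : ℕ) (x : J) :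
    (((tentMap s hs)^[n] x : J) : ℝ) = (tent s)^[n] x := by
  induction n with
  | zero => rfl
  | succ n ih => rw [Function.iterate_succ_apply', Function.iterate_succ_apply', ← ih]; rfl

lemma tent_abs (s x : ℝ) : tent s |x| = tent s x := by simp [tent]

/-- The kneading letters of the tent map, read off from the real line. -/
lemma IsKneadingInvariant.eventually_sign {s : ℝ} {hs : s ∈ Set.Ioc (0 : ℝ) 2} {e : ℕ → Bool}
    (he : IsKneadingInvariant (tentMap s hs) zeroJ e) (j : ℕ) :
    ∀ᶠ y in 𝓝[>] (0 : ℝ), (e j = true → 0 < (tent s)^[j] y) ∧ (e j = false → (tent s)^[j] y < 0) := by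
  have hp : Tendsto (Set.projIcc (-1 : ℝ) 1 (by norm_num)) (𝓝[>] (0 : ℝ)) (𝓝[>] zeroJ) := by
    have h0 : Set.projIcc (-1 : ℝ) 1 (by norm_num) 0 = zeroJ :=
      Set.projIcc_of_mem _ (by norm_num)
    refine tendsto_nhdsWithin_iff.2 ⟨?_, ?_⟩
    · rw [← h0]
      exact (continuous_projIcc.tendsto 0).mono_left nhdsWithin_le_nhds
    · filter_upwards [Ioo_mem_nhdsGT (zero_lt_one' ℝ)] with y hy
      rw [Set.projIcc_of_mem _ ⟨by linarith [hy.1], hy.2.le⟩]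
      exact hy.1
  filter_upwards [hp.eventually (he j), Ioo_mem_nhdsGT (zero_lt_one' ℝ)] with y hy hy1
  rw [Set.projIcc_of_mem _ ⟨by linarith [hy1.1], hy1.2.le⟩] at hy
  have hc := coe_tentMap_iterate hs j ⟨y, by linarith [hy1.1], hy1.2.le⟩
  unfold itinerary at hy
  have hz : ((zeroJ : J) : ℝ) = 0 := rfl
  split_ifs at hy with h1 h2
  · rw [← Subtype.coe_lt_coe, hc, hz] at h1
    have : e j = false := by simpa using hy.symm
    simpa [this] using h1
  · rw [← Subtype.coe_lt_coe, hc, hz] at h2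
    have : e j = true := by simpa using hy.symm
    simpa [this] using h2

/-- The critical orbit of the tent map of slope `s` follows the Fibonacci word `e`: the letter `e n`
is the side of `0` on which the `n`-th point lies. -/
structure IsFibonacciTent (s : ℝ) (e : ℕ → Bool) : Prop where
  one_lt : 1 < s
  le_two : s ≤ 2
  word : IsFibonacciWord e
  nonneg : ∀ n, e n = true → 0 ≤ (tent s)^[n] 0
  nonpos : ∀ n, e n = false → (tent s)^[n] 0 ≤ 0
  ne_zero : ∀ n, 0 < n → (tent s)^[n] 0 ≠ 0

lemma IsKneadingInvariant.isFibonacciTent {s : ℝ} {hs : s ∈ Set.Ioc (0 : ℝ) 2} {e : ℕ → Bool}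
    (he : IsKneadingInvariant (tentMap s hs) zeroJ e) (hw : IsFibonacciWord e) :
    IsFibonacciTent s e := by
  have hsign := he.eventually_sign
  have hlim : ∀ n, Tendsto (tent s)^[n] (𝓝[>] 0) (𝓝 ((tent s)^[n] 0)) := fun n =>
    (((continuous_tent s).iterate n).tendsto 0).mono_left nhdsWithin_le_nhds
  refine ⟨?_, hs.2, hw, fun n hn => ?_, fun n hn => ?_, fun p hp h0 => ?_⟩
  · obtain ⟨y, hy, hy0⟩ := ((hsign 1).and self_mem_nhdsWithin).exists
    have h1 := hy.1 hw.one
    have h2 : 0 < |y| := abs_pos.2 (ne_of_gt hy0)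
    simp only [Function.iterate_one, tent] at h1
    nlinarith [hs.1]
  · refine ge_of_tendsto (hlim n) ?_
    filter_upwards [hsign n] with y hy using (hy.1 hn).le
  · refine le_of_tendsto (hlim n) ?_
    filter_upwards [hsign n] with y hy using (hy.2 hn).le
  · -- if `0` had period `p`, its kneading sequence would have period `p`
    refine hw.not_periodic hp fun j hj => ?_
    have habs : Tendsto (fun y => |(tent s)^[p] y|) (𝓝[>] 0) (𝓝[>] 0) := by
      refine tendsto_nhdsWithin_iff.2 ⟨?_, ?_⟩
      · have := (hlim p).abs
        rwa [h0, abs_zero] at this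
      · filter_upwards [hsign p] with y hy
        rcases hb : e p with _ | _
        · exact abs_pos.2 (hy.2 hb).ne
        · exact abs_pos.2 (hy.1 hb).ne'
    obtain ⟨y, hy1, hy2⟩ := ((habs.eventually (hsign j)).and (hsign (p + j))).exists
    have hit : (tent s)^[j] |(tent s)^[p] y| = (tent s)^[p + j] y := by
      obtain ⟨i, rfl⟩ : ∃ i, j = i + 1 := ⟨j - 1, by omega⟩
      rw [add_comm p, Function.iterate_add_apply (tent s) (i + 1) p,
        Function.iterate_succ_apply, tent_abs, Function.iterate_succ_apply]
    rw [hit] at hy1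
    rcases hb : e j with _ | _ <;> rcases hb' : e (p + j) with _ | _
    · rfl
    · linarith [hy1.2 hb, hy2.1 hb']
    · linarith [hy1.1 hb, hy2.2 hb']
    · rfl

lemma tent_mem {s x : ℝ} (hs0 : 0 ≤ s) (hs2 : s ≤ 2) (hx : |x| ≤ 1) : |tent s x| ≤ 1 := by
  have := abs_nonneg x
  rw [tent, abs_le]
  constructor <;> nlinarith

lemma abs_iterate_tent_le {s x : ℝ} (hs0 : 0 ≤ s) (hs2 : s ≤ 2) (hx : |x| ≤ 1) (n : ℕ) :
    |(tent s)^[n] x| ≤ 1 := by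
  induction n with
  | zero => exact hx
  | succ n ih => rw [Function.iterate_succ_apply']; exact tent_mem hs0 hs2 ih

namespace IsFibonacciTent

variable {s : ℝ} {e : ℕ → Bool}

/-- As long as two pieces of the critical orbit are on the same side of `0`, their distance is
multiplied by `s` in each step. -/
lemma abs_iterate_add_sub (H : IsFibonacciTent s e) (M n : ℕ) (h : ∀ i, 0 < i → i < n → e (M + i) = e i) :
    |(tent s)^[M + n] 0 - (tent s)^[n] 0| = s ^ n * |(tent s)^[M] 0| := by
  have hs0 : 0 ≤ s := by linarith [H.one_lt]
  induction n with
  | zero => simp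
  | succ n ih =>
    have ih := ih fun i hi hin => h i hi (by omega)
    rw [← add_assoc, Function.iterate_succ_apply', Function.iterate_succ_apply', pow_succ', mul_assoc,
      ← ih, ← abs_of_nonneg hs0, ← abs_mul, abs_of_nonneg hs0]
    generalize hx : (tent s)^[M + n] 0 = x
    generalize hz : (tent s)^[n] 0 = z
    have hside : (0 ≤ x ∧ 0 ≤ z) ∨ (x ≤ 0 ∧ z ≤ 0) := by
      rcases n.eq_zero_or_pos with rfl | hn
      · have : z = 0 := by rw [← hz]; rfl
        rw [this]
        simpa using le_total 0 x
      · have hMn := h n hn (by omega)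
        rcases hb : e n with _ | _
        · exact .inr ⟨hx ▸ H.nonpos _ (hMn.trans hb), hz ▸ H.nonpos _ hb⟩
        · exact .inl ⟨hx ▸ H.nonneg _ (hMn.trans hb), hz ▸ H.nonneg _ hb⟩
    rcases hside with ⟨h1, h2⟩ | ⟨h1, h2⟩
    · rw [tent, tent, abs_of_nonneg h1, abs_of_nonneg h2, ← abs_neg]
      ring_nf
    · rw [tent, tent, abs_of_nonpos h1, abs_of_nonpos h2]
      ring_nf

/-- Points of the critical orbit at sparse times with digits `≥ k` are close to `0`. In the
inductive step, `N` and the two times `S k + N` and `S k` are compared, the latter two being sparse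
with digits `≥ k`. -/
lemma abs_le_of_fibSparse (H : IsFibonacciTent s e) (k : ℕ) :
    ∀ N, FibSparse k N → s ^ Nat.fib (k + 3) * |(tent s)^[N] 0| ≤ 2 ^ k * s ^ 2 := by
  have hs0 : 0 < s := by linarith [H.one_lt]
  induction k with
  | zero =>
    intro N _
    have := abs_iterate_tent_le hs0.le H.le_two (x := 0) (by simp) N
    have hsq : 0 ≤ s ^ 2 := by positivity
    have h3 : Nat.fib (0 + 3) = 2 := rfl
    rw [h3, pow_zero, one_mul]
    nlinarith
  | succ k ih =>
    intro N hN
    have h1 := ih _ (hN.carry k rfl)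
    have h2 := ih _ (FibSparse.fib k)
    have h3 := H.abs_iterate_add_sub N (Nat.fib (k + 2)) (H.word.shift hN)
    have h4 : |(tent s)^[N + Nat.fib (k + 2)] 0 - (tent s)^[Nat.fib (k + 2)] 0| ≤
        |(tent s)^[N + Nat.fib (k + 2)] 0| + |(tent s)^[Nat.fib (k + 2)] 0| :=
      (abs_sub_le _ 0 _).trans_eq (by simp)
    rw [h3, add_comm N] at h4
    have hfib : Nat.fib (k + 1 + 3) = Nat.fib (k + 3) + Nat.fib (k + 2) := by
      rw [show k + 1 + 3 = k + 2 + 2 by ring, Nat.fib_add_two, add_comm]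
    have h5 := mul_le_mul_of_nonneg_left h4 (show 0 ≤ s ^ Nat.fib (k + 3) by positivity)
    rw [hfib, pow_add, pow_succ 2 k]
    nlinarith

/-- If `e` has the letter `b` at two consecutive cutting times `S k` and `S (k + 1)`, every point of
the critical orbit comes, within `2 * S k` steps, close to `0` on the side given by `b`. -/
lemma exists_close (H : IsFibonacciTent s e) {b : Bool} {k : ℕ} (h0 : e (Nat.fib (k + 2)) = b)
    (h1 : e (Nat.fib (k + 3)) = b) (m : ℕ) :
    ∃ n ≤ 2 * Nat.fib (k + 2), 0 ≤ (if b then 1 else -1) * (tent s)^[m + n] 0 ∧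
      s ^ Nat.fib (k + 3) * |(tent s)^[m + n] 0| ≤ 2 ^ k * s ^ 2 := by
  have hside : ∀ N, (0 < N → e N = b) → 0 ≤ (if b then 1 else -1) * (tent s)^[N] 0 := by
    intro N hN
    rcases N.eq_zero_or_pos with rfl | hpos
    · simp
    · cases b with
      | false => simpa using H.nonpos N (hN hpos)
      | true => simpa using H.nonneg N (hN hpos)
  have hfirst : ∀ j M, FibSparse (j + 2) M → e (Nat.fib (j + 2) + M) = e (Nat.fib (j + 2)) := by
    intro j M hM
    rw [add_comm]
    exact H.word.shift hM _ (Nat.fib_pos.2 (by omega)) (Nat.fib_lt_fib_succ (by omega))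
  obtain ⟨n, hn, hsp⟩ := FibSparse.exists_add k m
  have hclose := H.abs_le_of_fibSparse k _ hsp
  generalize hN : m + n = N at hsp hclose
  cases hsp with
  | zero =>
    refine ⟨n, by omega, hside _ (by omega), by rwa [hN]⟩
  | @add _ j M hj hM =>
    by_cases hb : e (Nat.fib (j + 2)) = b
    · refine ⟨n, by omega, hside _ fun _ => ?_, by rwa [hN]⟩
      rw [hN, hfirst j M hM, hb]
    · -- the lowest digit `j` belongs to the wrong side, so that `j ≥ k + 2`: adding `S k` makes
      -- `k` the lowest digit
      have hjk : k + 2 ≤ j := by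
        by_contra hlt
        obtain rfl | rfl : j = k ∨ j = k + 1 := by omega
        · exact hb h0
        · exact hb h1
      have hM' : FibSparse (k + 2) (Nat.fib (j + 2) + M) := .add hjk hM
      have hmn : m + (n + Nat.fib (k + 2)) = Nat.fib (k + 2) + (Nat.fib (j + 2) + M) := by omega
      refine ⟨n + Nat.fib (k + 2), by omega, hside _ fun _ => ?_, ?_⟩
      · rw [hmn, hfirst k _ hM', h0]
      · rw [hmn]
        exact H.abs_le_of_fibSparse k _ (.add le_rfl hM')

/-- The close approaches of the critical orbit to `0` are inherited by its closure, since a bounded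
number of iterates is involved. -/
lemma exists_close_of_mem_closure (H : IsFibonacciTent s e) {b : Bool} {k : ℕ}
    (h0 : e (Nat.fib (k + 2)) = b) (h1 : e (Nat.fib (k + 3)) = b) {y : ℝ}
    (hy : y ∈ closure (Set.range fun m => (tent s)^[m] 0)) :
    ∃ n ≤ 2 * Nat.fib (k + 2), 0 ≤ (if b then 1 else -1) * (tent s)^[n] y ∧
      s ^ Nat.fib (k + 3) * |(tent s)^[n] y| ≤ 2 ^ k * s ^ 2 := by
  have hcont := fun n => (continuous_tent s).iterate n
  have hclosed : IsClosed (⋃ n ∈ Set.Iic (2 * Nat.fib (k + 2)),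
      {y : ℝ | 0 ≤ (if b then 1 else -1) * (tent s)^[n] y ∧
        s ^ Nat.fib (k + 3) * |(tent s)^[n] y| ≤ 2 ^ k * s ^ 2}) := by
    refine (Set.finite_Iic _).isClosed_biUnion fun n _ => ?_
    exact (isClosed_le continuous_const (continuous_const.mul (hcont n))).inter
      (isClosed_le (continuous_const.mul (hcont n).abs) continuous_const)
  have hsub := closure_minimal (s := Set.range fun m => (tent s)^[m] 0) ?_ hclosed
  · obtain ⟨n, hn, h⟩ := Set.mem_iUnion₂.1 (hsub hy)
    exact ⟨n, hn, h⟩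
  · rintro _ ⟨m, rfl⟩
    obtain ⟨n, hn, h⟩ := H.exists_close h0 h1 m
    rw [add_comm] at h
    refine Set.mem_biUnion (show n ∈ Set.Iic _ from hn) ?_
    simpa only [Set.mem_ofPred_eq, ← Function.iterate_add_apply] using h

end IsFibonacciTent

/-! ### Calculus on the interval -/

lemma realExt_coe (g : J → J) (x : J) : realExt g x = g x :=
  Set.IccExtend_val _ _ x

lemma mapsTo_realExt (g : J → J) :
    Set.MapsTo (realExt g) (Set.Icc (-1 : ℝ) 1) (Set.Icc (-1 : ℝ) 1) :=
  fun _ _ => (g _).2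

lemma realExt_comp (g₁ g₂ : J → J) : realExt (g₁ ∘ g₂) = realExt g₁ ∘ realExt g₂ := by
  funext z
  exact (realExt_coe g₁ (g₂ _)).symm

lemma HasDerivJ.comp {g₁ g₂ : J → J} {d₁ d₂ : ℝ} {x : J} (h₁ : HasDerivJ g₁ d₁ (g₂ x))
    (h₂ : HasDerivJ g₂ d₂ x) : HasDerivJ (g₁ ∘ g₂) (d₁ * d₂) x := by
  unfold HasDerivJ at *
  rw [realExt_comp]
  exact h₁.comp_of_eq _ h₂ (mapsTo_realExt g₂) (realExt_coe g₂ x).symm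

lemma HasDerivJ.derivJ_eq {g : J → J} {d : ℝ} {x : J} (h : HasDerivJ g d x) : derivJ g x = d :=
  HasDerivWithinAt.derivWithin h (uniqueDiffOn_Icc (by norm_num) _ x.2)

lemma HasDerivJ.symm {h : J ≃ₜ J} {d : ℝ} {x : J} (hd : HasDerivJ h d x) (h0 : d ≠ 0) :
    HasDerivJ h.symm d⁻¹ (h x) := by
  have hleft : realExt h.symm (h x) = x := by rw [realExt_coe]; simp
  have hcont : Continuous (realExt h.symm) :=
    (continuous_subtype_val.comp h.symm.continuous).Icc_extend'
  unfold HasDerivJ at *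
  rw [hasDerivWithinAt_iff_hasFDerivWithinAt] at *
  rw [← hleft] at hd
  refine HasFDerivWithinAt.of_local_left_inverse (f := realExt h)
    (f' := ContinuousLinearEquiv.unitsEquivAut ℝ (Units.mk0 d h0))
    (t := Set.Icc (-1 : ℝ) 1) ?_ ?_ ?_ ?_
  · exact hcont.continuousWithinAt.tendsto_nhdsWithin (mapsTo_realExt _)
  · exact hd.congr_fderiv (by ext; simp)
  · exact (h x).2
  · filter_upwards [self_mem_nhdsWithin] with z hz
    have := realExt_coe h (h.symm ⟨z, hz⟩)
    rw [← realExt_coe h.symm ⟨z, hz⟩] at this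
    simpa using this

/-! ### Iterates of the tent map near a point -/

lemma eventually_tent_affine {s w : ℝ} (hs : 0 ≤ s) (hw : w ≠ 0) :
    ∃ a, |a| = s ∧ ∀ᶠ z in 𝓝 w, tent s z = tent s w + a * (z - w) := by
  rcases hw.lt_or_gt with h | h
  · refine ⟨s, abs_of_nonneg hs, ?_⟩
    filter_upwards [Iio_mem_nhds h] with z hz
    rw [tent, tent, abs_of_neg h, abs_of_neg hz]
    ring
  · refine ⟨-s, by rw [abs_neg, abs_of_nonneg hs], ?_⟩
    filter_upwards [Ioi_mem_nhds h] with z hz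
    rw [tent, tent, abs_of_pos h, abs_of_pos hz]
    ring

lemma eventually_iterate_affine {s y : ℝ} (hs : 0 ≤ s) {n : ℕ}
    (hy : ∀ i < n, (tent s)^[i] y ≠ 0) :
    ∃ a, |a| = s ^ n ∧ ∀ᶠ z in 𝓝 y, (tent s)^[n] z = (tent s)^[n] y + a * (z - y) := by
  induction n with
  | zero => exact ⟨1, by simp, by simp⟩
  | succ n ih =>
    obtain ⟨a, ha, hz⟩ := ih fun i hi => hy i (by omega)
    obtain ⟨a', ha', hz'⟩ := eventually_tent_affine hs (hy n (by omega))
    refine ⟨a' * a, by rw [abs_mul, ha, ha', pow_succ'], ?_⟩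
    filter_upwards [hz, ((continuous_tent s).iterate n).continuousAt.eventually hz'] with z h1 h2
    rw [Function.iterate_succ_apply', Function.iterate_succ_apply', h2, h1]
    ring

/-- An iterate passing through the turning point has a corner. -/
lemma eventually_iterate_corner {s y : ℝ} (hs : 0 ≤ s) {m n : ℕ} (hmn : m < n)
    (hy : ∀ i < m, (tent s)^[i] y ≠ 0) (hm : (tent s)^[m] y = 0)
    (hc : ∀ i, 0 < i → (tent s)^[i] 0 ≠ 0) :
    ∃ a, |a| = s ^ n ∧ ∀ᶠ z in 𝓝 y, (tent s)^[n] z = (tent s)^[n] y + a * |z - y| := by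
  obtain ⟨l, rfl⟩ : ∃ l, n = l + (1 + m) := ⟨n - m - 1, by omega⟩
  obtain ⟨a, ha, hz⟩ := eventually_iterate_affine hs hy
  have hc' : ∀ i < l, (tent s)^[i] (tent s 0) ≠ 0 := fun i _ => by
    simpa using hc (i + 1) (by omega)
  obtain ⟨a', ha', hz'⟩ := eventually_iterate_affine hs hc'
  have hit : ∀ z, (tent s)^[l + (1 + m)] z = (tent s)^[l] (tent s ((tent s)^[m] z)) := fun z => by
    rw [Function.iterate_add_apply, Function.iterate_add_apply, Function.iterate_one]
  refine ⟨-a' * (s * |a|), ?_, ?_⟩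
  · rw [abs_mul, abs_neg, ha', ha, abs_of_nonneg (by positivity)]
    ring
  · have ht : ContinuousAt (fun z => tent s ((tent s)^[m] z)) y :=
      ((continuous_tent s).comp ((continuous_tent s).iterate m)).continuousAt
    have ht0 : tent s ((tent s)^[m] y) = tent s 0 := by rw [hm]
    filter_upwards [hz, (ht0 ▸ ht.tendsto).eventually hz'] with z h1 h2
    rw [hit, hit, h2, ht0, h1, hm, tent, tent, zero_add, abs_mul, abs_zero]
    ring

lemma hasDerivJ_tentMap_iterate {s : ℝ} (hs : s ∈ Set.Ioc (0 : ℝ) 2) {y : J} {n : ℕ}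
    (hy : ∀ i < n, (tent s)^[i] (y : ℝ) ≠ 0) :
    ∃ a, |a| = s ^ n ∧ HasDerivJ (tentMap s hs)^[n] a y := by
  obtain ⟨a, ha, hz⟩ := eventually_iterate_affine hs.1.le hy
  refine ⟨a, ha, ?_⟩
  have hd : HasDerivWithinAt (fun z : ℝ => (tent s)^[n] y + a * (z - y)) a
      (Set.Icc (-1 : ℝ) 1) y := by
    simpa using (((hasDerivWithinAt_id (y : ℝ) _).sub_const (y : ℝ)).const_mul a).const_add
      ((tent s)^[n] (y : ℝ))
  refine hd.congr_of_eventuallyEq_of_mem ?_ y.2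
  filter_upwards [self_mem_nhdsWithin, nhdsWithin_le_nhds hz] with z hzI hz
  rw [← hz, ← coe_tentMap_iterate hs n ⟨z, hzI⟩]
  exact realExt_coe _ ⟨z, hzI⟩

lemma iterate_conj {h : J ≃ₜ J} {g f : J → J} (hf : f = h ∘ g ∘ h.symm) (n : ℕ) :
    f^[n] = h ∘ g^[n] ∘ h.symm := by
  have hsc : Function.Semiconj h g f := fun z => by simp [hf]
  funext z
  have := (hsc.iterate_right n).eq (h.symm z)
  simpa using this.symm

/-! ### Iterates of the conjugate map -/

/-- The chain rule for `fⁿ = h ∘ Tⁿ ∘ h⁻¹` at an image `h y`, when the orbit of `y` avoids the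
turning point. -/
lemma hasDerivJ_iterate_conj {s : ℝ} (hs : s ∈ Set.Ioc (0 : ℝ) 2) {h : J ≃ₜ J} {f : J → J}
    (hf : f = h ∘ tentMap s hs ∘ h.symm) (hh : ∀ z : J, (z : ℝ) ≠ 0 → ∃ d ≠ 0, HasDerivJ h d z)
    {y : J} (hy : ∀ i, (tent s)^[i] (y : ℝ) ≠ 0) (n : ℕ) :
    ∃ d ≠ 0, HasDerivJ (f^[n]) d (h y) ∧ Real.log |d| = n * Real.log s +
      Real.log |derivJ h ((tentMap s hs)^[n] y)| - Real.log |derivJ h y| := by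
  obtain ⟨a, ha, haT⟩ := hasDerivJ_tentMap_iterate hs (y := y) (n := n) fun i _ => hy i
  obtain ⟨d₀, h0, hd₀⟩ := hh y (hy 0)
  obtain ⟨d, hd0, hd⟩ := hh ((tentMap s hs)^[n] y) (by rw [coe_tentMap_iterate]; exact hy n)
  have hspos : 0 < s ^ n := pow_pos hs.1 n
  have ha0 : a ≠ 0 := by rw [← abs_pos, ha]; exact hspos
  refine ⟨d * (a * d₀⁻¹), mul_ne_zero hd0 (mul_ne_zero ha0 (inv_ne_zero h0)), ?_, ?_⟩
  · rw [iterate_conj hf]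
    have hy' : h.symm (h y) = y := h.symm_apply_apply y
    refine HasDerivJ.comp ?_ (HasDerivJ.comp ?_ (hd₀.symm h0))
    · rw [Function.comp_apply, hy']; exact hd
    · rw [hy']; exact haT
  · rw [hd.derivJ_eq, hd₀.derivJ_eq, abs_mul, abs_mul, abs_inv, ha,
      Real.log_mul (abs_ne_zero.2 hd0) (by positivity), Real.log_mul hspos.ne' (by positivity),
      Real.log_inv, Real.log_pow]
    ring

/-- When the orbit of `y` reaches the turning point, `h ∘ Tⁿ` has at `y` one-sided derivatives of
opposite signs, and so `fⁿ` cannot be differentiable at `h y`. -/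
lemma not_hasDerivJ_iterate_conj {s : ℝ} (hs : s ∈ Set.Ioc (0 : ℝ) 2) {h : J ≃ₜ J} {f : J → J}
    (hf : f = h ∘ tentMap s hs ∘ h.symm) (hh : ∀ z : J, (z : ℝ) ≠ 0 → ∃ d ≠ 0, HasDerivJ h d z)
    (hh0 : HasDerivJ h 0 zeroJ) (hc : ∀ i, 0 < i → (tent s)^[i] 0 ≠ 0) {y : J} {m : ℕ}
    (hm : (tent s)^[m] (y : ℝ) = 0) (hmin : ∀ i < m, (tent s)^[i] (y : ℝ) ≠ 0)
    {n : ℕ} (hmn : m < n) (d : ℝ) : ¬ HasDerivJ (f^[n]) d (h y) := by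
  intro hd
  obtain ⟨a, ha, hz⟩ := eventually_iterate_corner hs.1.le hmn hmin hm hc
  have ha0 : a ≠ 0 := by rw [← abs_pos, ha]; exact pow_pos hs.1 n
  -- the end points are mapped to the fixed point `-1`
  have hyI : (y : ℝ) ∈ Set.Ioo (-1 : ℝ) 1 := by
    have hne : |(y : ℝ)| ≠ 1 := by
      intro h1
      have hit : ∀ i, |(tent s)^[i] (y : ℝ)| = 1 := by
        intro i
        induction i with
        | zero => exact h1
        | succ i ih => rw [Function.iterate_succ_apply', tent, ih]; simp
      have := hit m
      simp [hm] at this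
    exact abs_lt.1 (lt_of_le_of_ne (abs_le.2 y.2) hne)
  obtain ⟨d₀, hd₀⟩ : ∃ d₀, HasDerivJ h d₀ y := by
    by_cases hy0 : (y : ℝ) = 0
    · exact ⟨0, by rwa [show y = zeroJ from Subtype.ext hy0]⟩
    · obtain ⟨d₀, -, hd₀⟩ := hh y hy0
      exact ⟨d₀, hd₀⟩
  have hTn : (tent s)^[n] (y : ℝ) ≠ 0 := by
    rw [show n = (n - m) + m by omega, Function.iterate_add_apply, hm]
    exact hc _ (by omega)
  obtain ⟨d₁, hd₁0, hd₁⟩ := hh ((tentMap s hs)^[n] y) (by rwa [coe_tentMap_iterate])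
  -- `h ∘ Tⁿ = fⁿ ∘ h` is differentiable at `y`
  have hcomp : HasDerivAt (realExt (h ∘ (tentMap s hs)^[n])) (d * d₀) y := by
    have : h ∘ (tentMap s hs)^[n] = f^[n] ∘ h := by
      rw [iterate_conj hf]; funext z; simp
    rw [this]
    exact (hd.comp hd₀).hasDerivAt (Icc_mem_nhds hyI.1 hyI.2)
  have hI : ∀ᶠ z in 𝓝 (y : ℝ), z ∈ Set.Icc (-1 : ℝ) 1 := Icc_mem_nhds hyI.1 hyI.2
  -- a one-sided derivative along a set where `|z - y| = b * (z - y)`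
  have hside : ∀ (b : ℝ) (u : Set ℝ), UniqueDiffWithinAt ℝ u y →
      (∀ z ∈ u, |z - y| = b * (z - y)) → d * d₀ = d₁ * (a * b) := by
    intro b u hu hb
    have hlin : HasDerivWithinAt (fun z : ℝ => (tent s)^[n] y + (a * b) * (z - y)) (a * b)
        (u ∩ Set.Icc (-1 : ℝ) 1) y := by
      simpa using (((hasDerivWithinAt_id (y : ℝ) _).sub_const (y : ℝ)).const_mul (a * b)).const_add
        ((tent s)^[n] (y : ℝ))
    have hT : HasDerivWithinAt (realExt (tentMap s hs)^[n]) (a * b)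
        (u ∩ Set.Icc (-1 : ℝ) 1) y := by
      refine hlin.congr_of_eventuallyEq ?_ ?_
      · filter_upwards [self_mem_nhdsWithin, nhdsWithin_le_nhds hz] with z hzu hz
        rw [mul_assoc, ← hb z hzu.1, ← hz, ← coe_tentMap_iterate hs n ⟨z, hzu.2⟩]
        exact realExt_coe _ ⟨z, hzu.2⟩
      · rw [realExt_coe, coe_tentMap_iterate]; simp
    have h1 := HasDerivWithinAt.comp_of_eq (y : ℝ) hd₁ hT
      ((mapsTo_realExt _).mono_left Set.inter_subset_right) (realExt_coe _ y).symm
    rw [← realExt_comp] at h1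
    exact (hu.inter hI).eq_deriv _ hcomp.hasDerivWithinAt h1
  have hr := hside 1 (Set.Ici y) (uniqueDiffOn_Ici _ _ Set.self_mem_Ici) fun z hz => by
    rw [one_mul, abs_of_nonneg (sub_nonneg.2 hz)]
  have hl := hside (-1) (Set.Iic y) (uniqueDiffOn_Iic _ _ Set.self_mem_Iic) fun z hz => by
    rw [abs_of_nonpos (sub_nonpos.2 hz)]; ring
  have : d₁ * a = 0 := by linarith
  exact mul_ne_zero hd₁0 ha0 this

/-! ### The conjugacy away from the critical point -/

lemma continuousOn_derivWithin_of_analyticOn {H : ℝ → ℝ}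
    (hH : AnalyticOn ℝ H (Set.Icc (-1 : ℝ) 1 \ {0})) :
    ContinuousOn (derivWithin H (Set.Icc (-1 : ℝ) 1)) (Set.Icc (-1 : ℝ) 1 \ {0}) := by
  have hu : UniqueDiffOn ℝ (Set.Icc (-1 : ℝ) 1 \ {0}) :=
    (uniqueDiffOn_Icc (by norm_num)).inter isOpen_compl_singleton
  refine ((hH.contDiffOn (n := 1) hu).continuousOn_derivWithin hu le_rfl).congr fun z hz => ?_
  exact (derivWithin_inter (isOpen_compl_singleton.mem_nhds hz.2)).symm

lemma exists_hasDerivJ_ne_zero {h : J → J}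
    (han : AnalyticOn ℝ (realExt h) (Set.Icc (-1 : ℝ) 1 \ {0})) (huniq : critSet h = {zeroJ})
    (z : J) (hz : (z : ℝ) ≠ 0) : ∃ d ≠ 0, HasDerivJ h d z := by
  have hd : DifferentiableWithinAt ℝ (realExt h) (Set.Icc (-1 : ℝ) 1) z :=
    (differentiableWithinAt_inter (isOpen_compl_singleton.mem_nhds hz)).1
      (han.differentiableOn z ⟨z.2, hz⟩)
  refine ⟨_, fun h0 => hz ?_, hd.hasDerivWithinAt⟩
  have : z ∈ critSet h := by
    have := hd.hasDerivWithinAt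
    rwa [h0] at this
  rw [huniq] at this
  rw [this]; rfl

/-- Away from its critical point, the derivative of `h` is bounded away from `0` and `∞`. -/
lemma exists_abs_log_derivJ_le {h : J → J}
    (han : AnalyticOn ℝ (realExt h) (Set.Icc (-1 : ℝ) 1 \ {0})) (huniq : critSet h = {zeroJ})
    {η : ℝ} (hη : 0 < η) : ∃ C, ∀ z : J, η ≤ |(z : ℝ)| → |Real.log (|derivJ h z|)| ≤ C := by
  have hcpt : IsCompact (Set.Icc (-1 : ℝ) 1 ∩ {z | η ≤ |z|}) :=
    isCompact_Icc.inter_right (isClosed_le continuous_const continuous_abs)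
  have hne : ∀ z, η ≤ |z| → z ≠ 0 := fun z hz h0 => by
    rw [h0, abs_zero] at hz; linarith
  obtain ⟨C, hC⟩ := hcpt.exists_bound_of_continuousOn
    (f := fun z => Real.log |derivWithin (realExt h) (Set.Icc (-1 : ℝ) 1) z|) (by
      refine ContinuousOn.log ?_ ?_
      · exact ((continuousOn_derivWithin_of_analyticOn han).mono
          fun z hz => ⟨hz.1, hne z hz.2⟩).abs
      · intro z hz
        obtain ⟨d, hd0, hd⟩ := exists_hasDerivJ_ne_zero han huniq ⟨z, hz.1⟩ (hne z hz.2)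
        have : derivWithin (realExt h) (Set.Icc (-1 : ℝ) 1) z = d := hd.derivJ_eq
        rwa [this, abs_ne_zero])
  exact ⟨C, fun z hz => hC z ⟨z.2, hz⟩⟩

/-- On one of the two sides of the critical point, the derivative of `h` vanishes to the larger of
the two orders. -/
lemma IsNonflatCritical.exists_side {h : J → J} {ap am : ℝ}
    (hnf : IsNonflatCritical h zeroJ ap am) :
    ∃ (b : Bool) (M δ : ℝ), 0 < δ ∧ ∀ z : J, 0 < (if b then 1 else -1) * (z : ℝ) → |(z : ℝ)| < δ →
      Real.log |derivJ h z| ≤ M + max ap am * Real.log |(z : ℝ)| := by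
  obtain ⟨M, -, δ, hδ, hr, hl⟩ := hnf.bound
  have hz0 : ((zeroJ : J) : ℝ) = 0 := rfl
  simp only [hz0, zero_add, zero_sub, sub_zero] at hr hl
  have key : ∀ (z : J) (α : ℝ), (z : ℝ) ≠ 0 → (∃ d : ℝ, d ≠ 0 ∧ HasDerivJ h d z ∧
      |Real.log (|d| / |(z : ℝ)| ^ α)| ≤ M) →
      Real.log |derivJ h z| ≤ M + α * Real.log |(z : ℝ)| := by
    rintro z α hz ⟨d, hd0, hd, hM⟩
    have hzpos := abs_pos.2 hz
    rw [Real.log_div (abs_ne_zero.2 hd0) (Real.rpow_pos_of_pos hzpos _).ne',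
      Real.log_rpow hzpos] at hM
    rw [hd.derivJ_eq]
    linarith [(abs_le.1 hM).2]
  rcases le_total am ap with hle | hle
  · refine ⟨true, M, δ, hδ, fun z hz hzδ => ?_⟩
    have hz : 0 < (z : ℝ) := by simpa using hz
    rw [max_eq_left hle]
    exact key z ap hz.ne' (hr z hz (abs_lt.1 hzδ).2)
  · refine ⟨false, M, δ, hδ, fun z hz hzδ => ?_⟩
    have hz : (z : ℝ) < 0 := by simpa using hz
    rw [max_eq_right hle]
    exact key z am hz.ne (hl z (abs_lt.1 hzδ).1 hz)

/-! ### Growth of the Fibonacci numbers -/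

lemma sq_le_sixteen_mul_fib (n : ℕ) : n ^ 2 ≤ 16 * Nat.fib (n + 1) := by
  induction n using Nat.strong_induction_on with
  | _ n ih =>
    match n with
    | 0 | 1 | 2 | 3 | 4 => decide
    | n + 5 =>
      have h1 := ih (n + 3) (by omega)
      have h2 := ih (n + 4) (by omega)
      rw [Nat.fib_add_two (n := n + 4)]
      simp only [add_assoc, Nat.reduceAdd] at *
      clear ih
      nlinarith [Nat.zero_le (n * n), Nat.zero_le n]

lemma eventually_affine_le_fib (A B : ℝ) {c : ℝ} (hc : 0 < c) :
    ∀ᶠ k : ℕ in atTop, A + B * k ≤ c * Nat.fib (k + 1) := by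
  filter_upwards [eventually_ge_atTop (max 1 ⌈16 * (|A| + |B|) / c⌉₊)] with k hk
  have hk1 : (1 : ℝ) ≤ k := by exact_mod_cast (le_max_left _ _).trans hk
  have hk2 : 16 * (|A| + |B|) / c ≤ k := Nat.ceil_le.1 ((le_max_right _ _).trans hk)
  have hsq : (k : ℝ) ^ 2 ≤ 16 * Nat.fib (k + 1) := by exact_mod_cast sq_le_sixteen_mul_fib k
  rw [div_le_iff₀ hc] at hk2
  have h1 := le_abs_self A
  have h2 := le_abs_self B
  have h3 := abs_nonneg A
  have h4 : 16 * (A + B * k) ≤ 16 * (|A| + |B|) * k := by nlinarith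
  nlinarith

/-- The time `2 * S k` is shorter than `φ * S (k + 1)`, by a margin of order `S k`. -/
lemma two_mul_fib_div_goldenRatio_le (k : ℕ) :
    2 * (Nat.fib (k + 2) : ℝ) / Real.goldenRatio ≤
      Nat.fib (k + 3) - (1 / 2) * Nat.fib (k + 1) := by
  have hmono : (Nat.fib k : ℝ) ≤ Nat.fib (k + 1) := by exact_mod_cast Nat.fib_le_fib_succ
  have h2 : (Nat.fib (k + 2) : ℝ) = Nat.fib k + Nat.fib (k + 1) := by
    exact_mod_cast Nat.fib_add_two
  have h3 : (Nat.fib (k + 3) : ℝ) = Nat.fib (k + 1) + Nat.fib (k + 2) := by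
    exact_mod_cast Nat.fib_add_two (n := k + 1)
  have hφ : (8 : ℝ) / 5 ≤ Real.goldenRatio := by
    have : (11 : ℝ) / 5 ≤ √5 := Real.le_sqrt_of_sq_le (by norm_num)
    unfold Real.goldenRatio
    linarith
  have hk : (0 : ℝ) ≤ Nat.fib k := Nat.cast_nonneg _
  rw [div_le_iff₀ Real.goldenRatio_pos, h3, h2]
  nlinarith

/-! ### Finite-time exponents along orbits in the closure of the critical orbit -/

/-- Along the close approaches to the side `b` of the turning point, on which `u` is bounded by
`α * log |z|`, the averages of `log s + u` fall to `(1 - α / φ) * log s`. -/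
lemma IsFibonacciTent.frequently_average_le {s : ℝ} {e : ℕ → Bool} (H : IsFibonacciTent s e)
    {y : ℝ} (hy : y ∈ closure (Set.range fun m => (tent s)^[m] 0))
    (hne : ∀ n, (tent s)^[n] y ≠ 0) {u : ℕ → ℝ} {b : Bool} {M δ α : ℝ} (hδ : 0 < δ) (hα : 0 < α)
    (hu : ∀ n, 0 < (if b then 1 else -1) * (tent s)^[n] y → |(tent s)^[n] y| < δ →
      u n ≤ M + α * Real.log |(tent s)^[n] y|) (D : ℝ) :
    ∃ᶠ n : ℕ in atTop, 1 / (n : ℝ) * (n * Real.log s + u n - D) ≤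
      (1 - α / Real.goldenRatio) * Real.log s := by
  have hL : 0 < Real.log s := Real.log_pos H.one_lt
  have hs0 : 0 < s := by linarith [H.one_lt]
  rw [frequently_atTop]
  intro N
  -- approaches closer than all those up to time `N` happen after time `N`
  obtain ⟨ρ, hρ⟩ := ((Set.finite_Iic N).image fun i => Real.log |(tent s)^[i] y|).bddBelow
  have hρ : ∀ i ≤ N, ρ ≤ Real.log |(tent s)^[i] y| := fun i hi => hρ (Set.mem_image_of_mem _ hi)
  obtain ⟨K, hK⟩ := eventually_atTop.1
    (((eventually_affine_le_fib (2 * Real.log s - ρ + 1) (Real.log 2) hL).and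
      (eventually_affine_le_fib (2 * Real.log s - Real.log δ + 1) (Real.log 2) hL)).and
      (eventually_affine_le_fib (M - D + α * (2 * Real.log s)) (α * Real.log 2)
        (show 0 < α * Real.log s / 2 by positivity)))
  obtain ⟨k, hkK, h0, h1⟩ := H.word.exists_pair b K
  obtain ⟨⟨hk1, hk2⟩, hk3⟩ := hK k hkK
  obtain ⟨n, hn, hside, hclose⟩ := H.exists_close_of_mem_closure h0 h1 hy
  have hpos : 0 < |(tent s)^[n] y| := abs_pos.2 (hne n)
  have hlog : Real.log |(tent s)^[n] y| ≤
      k * Real.log 2 + 2 * Real.log s - Nat.fib (k + 3) * Real.log s := by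
    have := Real.log_le_log (by positivity) hclose
    rw [Real.log_mul (by positivity) hpos.ne', Real.log_mul (by positivity) (by positivity),
      Real.log_pow, Real.log_pow, Real.log_pow] at this
    push_cast at this
    linarith
  have hfib : Real.log s * Nat.fib (k + 1) ≤ Nat.fib (k + 3) * Real.log s := by
    rw [mul_comm]
    have : (Nat.fib (k + 1) : ℝ) ≤ Nat.fib (k + 3) := by exact_mod_cast Nat.fib_mono (by omega)
    gcongr
  have hnN : N < n := by
    by_contra! hle
    linarith [hρ n hle]
  have hnδ : |(tent s)^[n] y| < δ := by
    rw [← Real.log_lt_log_iff hpos hδ]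
    linarith
  have hside' : 0 < (if b then 1 else -1) * (tent s)^[n] y :=
    lt_of_le_of_ne hside (mul_ne_zero (by split_ifs <;> norm_num) (hne n)).symm
  have hun := hu n hside' hnδ
  refine ⟨n, hnN.le, ?_⟩
  have hn0 : (0 : ℝ) < n := by exact_mod_cast (Nat.zero_le N).trans_lt hnN
  have hnφ : (n : ℝ) / Real.goldenRatio ≤ Nat.fib (k + 3) - (1 / 2) * Nat.fib (k + 1) := by
    refine le_trans ?_ (two_mul_fib_div_goldenRatio_le k)
    have : (n : ℝ) ≤ 2 * Nat.fib (k + 2) := by exact_mod_cast hn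
    have := Real.goldenRatio_pos
    gcongr
  have h2 := mul_le_mul_of_nonneg_left hlog hα.le
  have h3 := mul_le_mul_of_nonneg_left hnφ (show 0 ≤ α * Real.log s by positivity)
  have key : n * Real.log s + u n - D ≤
      n * Real.log s - α * Real.log s * (n / Real.goldenRatio) := by
    linarith
  calc 1 / (n : ℝ) * (n * Real.log s + u n - D)
      ≤ 1 / (n : ℝ) * (n * Real.log s - α * Real.log s * (n / Real.goldenRatio)) := by gcongr
    _ = (1 - α / Real.goldenRatio) * Real.log s := by
      have := Real.goldenRatio_ne_zero
      field_simp

/-- An orbit of the tent map is never close to the turning point twice in a row. If `u` is bounded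
below away from the turning point, the averages of `log s + u` return to every value below
`log s`. -/
lemma frequently_lt_average {s : ℝ} (hs : 1 < s) {y : ℝ} {u : ℕ → ℝ} {C : ℝ}
    (hu : ∀ n, (s - 1) / (s + 1) ≤ |(tent s)^[n] y| → -C ≤ u n) (D : ℝ) {c : ℝ}
    (hc : c < Real.log s) :
    ∃ᶠ n : ℕ in atTop, c ≤ 1 / (n : ℝ) * (n * Real.log s + u n - D) := by
  rw [frequently_atTop]
  intro N
  set N' := max (N + 1) ⌈(C + D) / (Real.log s - c)⌉₊ with hN'
  obtain ⟨n, hn, hfar⟩ : ∃ n ≥ N', (s - 1) / (s + 1) ≤ |(tent s)^[n] y| := by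
    by_cases hfar : (s - 1) / (s + 1) ≤ |(tent s)^[N'] y|
    · exact ⟨N', le_rfl, hfar⟩
    · refine ⟨N' + 1, by omega, le_trans ?_ (le_abs_self _)⟩
      rw [not_le, lt_div_iff₀ (by linarith)] at hfar
      rw [Function.iterate_succ_apply', tent, div_le_iff₀ (by linarith)]
      nlinarith
  have hn1 : N + 1 ≤ n := (le_max_left _ _).trans hn
  have hn2 : (C + D) / (Real.log s - c) ≤ n := Nat.ceil_le.1 ((le_max_right _ _).trans hn)
  have hn0 : (0 : ℝ) < n := by exact_mod_cast (by omega : 0 < n)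
  refine ⟨n, by omega, ?_⟩
  rw [div_le_iff₀ (by linarith)] at hn2
  rw [one_div_mul_eq_div, le_div_iff₀ hn0]
  linarith [hu n hfar]

end LorenzFib

theorem mainTheorem3 (lam : ℝ) (hlam : lam ∈ Set.Ioc (0 : ℝ) 2)
    (hfib : HasFibonacciRecurrence (tentMap lam hlam) zeroJ)
    (h : J ≃ₜ J)
    (han : AnalyticOn ℝ (realExt h) (Set.Icc (-1 : ℝ) 1 \ {0}))
    (ap am : ℝ) (hnf : IsNonflatCritical h zeroJ ap am)
    (huniq : critSet h = {zeroJ})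
    (f : J → J) (hf : f = h ∘ tentMap lam hlam ∘ h.symm) :
    ∀ x ∈ closure (orbit f (h zeroJ)),
      (h zeroJ ∉ orbit f x →
        (∀ n : ℕ, ∃ d : ℝ, d ≠ 0 ∧ HasDerivJ (f^[n]) d x) ∧
        liminf (lyapSeq f x) atTop
          ≤ (((1 - max ap am / Real.goldenRatio) * Real.log lam : ℝ) : EReal) ∧
        (1 - max ap am / Real.goldenRatio) * Real.log lam < Real.log lam ∧
        ((Real.log lam : ℝ) : EReal) ≤ limsup (lyapSeq f x) atTop ∧
        ¬ ∃ χ : EReal, Tendsto (lyapSeq f x) atTop (𝓝 χ)) ∧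
      ((orbit f x ∩ singularSet f (h zeroJ)).Nonempty →
        ∀ᶠ n : ℕ in atTop, ¬ ∃ d : ℝ, HasDerivJ (f^[n]) d x) := by
  intro x hx
  obtain ⟨e, he, hw⟩ := hfib.exists_word
  have H := he.isFibonacciTent hw
  have hh := exists_hasDerivJ_ne_zero han huniq
  obtain ⟨y, rfl⟩ := h.surjective x
  have hfit : ∀ n z, f^[n] (h z) = h ((tentMap lam hlam)^[n] z) := fun n z => by
    simp [iterate_conj hf]
  have hit : ∀ n, f^[n] (h y) = h zeroJ ↔ (tent lam)^[n] (y : ℝ) = 0 := fun n => by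
    rw [hfit, h.injective.eq_iff, ← coe_tentMap_iterate hlam]
    exact Subtype.ext_iff
  constructor
  · intro hnot
    have hne : ∀ n, (tent lam)^[n] (y : ℝ) ≠ 0 := fun n h0 => hnot ⟨n, (hit n).2 h0⟩
    have hy : (y : ℝ) ∈ closure (Set.range fun m => (tent lam)^[m] 0) := by
      have := map_mem_closure (continuous_subtype_val.comp h.symm.continuous) hx
        (t := Set.range fun m => (tent lam)^[m] 0) ?_
      · simpa using this
      · rintro _ ⟨m, rfl⟩
        refine ⟨m, ?_⟩
        simp only [Function.comp_apply, hfit, h.symm_apply_apply, coe_tentMap_iterate]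
        rfl
    have hderiv := hasDerivJ_iterate_conj hlam hf hh hne
    have hlyap : ∀ n, lyapSeq f (h y) n = ((1 / (n : ℝ) * (n * Real.log lam +
        Real.log |derivJ h ((tentMap lam hlam)^[n] y)| - Real.log |derivJ h y|) : ℝ) : EReal) := by
      intro n
      obtain ⟨d, -, hd, hlog⟩ := hderiv n
      rw [lyapSeq, hd.derivJ_eq, hlog]
    have hL : 0 < Real.log lam := Real.log_pos H.one_lt
    have hα : 0 < max ap am := hnf.right_pos.trans_le (le_max_left _ _)
    have hlt : (1 - max ap am / Real.goldenRatio) * Real.log lam < Real.log lam := by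
      have := div_pos hα Real.goldenRatio_pos
      nlinarith
    have hinf : liminf (lyapSeq f (h y)) atTop
        ≤ (((1 - max ap am / Real.goldenRatio) * Real.log lam : ℝ) : EReal) := by
      obtain ⟨b, M, δ, hδ, hside⟩ := hnf.exists_side
      refine liminf_le_of_frequently_le' ((H.frequently_average_le hy hne
        (b := b) (M := M) (u := fun n => Real.log |derivJ h ((tentMap lam hlam)^[n] y)|) hδ hα (fun n h1 h2 => ?_)
        (Real.log |derivJ h y|)).mono fun n hn => ?_)
      · rw [← coe_tentMap_iterate hlam] at h1 h2 ⊢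
        exact hside _ h1 h2
      · rw [hlyap]
        exact EReal.coe_le_coe_iff.2 hn
    have hsup : ((Real.log lam : ℝ) : EReal) ≤ limsup (lyapSeq f (h y)) atTop := by
      obtain ⟨C, hC⟩ := exists_abs_log_derivJ_le han huniq
        (η := (lam - 1) / (lam + 1)) (div_pos (by linarith [H.one_lt]) (by linarith [H.one_lt]))
      refine EReal.ge_of_forall_gt_iff_ge.1 fun c hc => ?_
      refine le_limsup_of_frequently_le' ((frequently_lt_average H.one_lt (y := y)
        (u := fun n => Real.log |derivJ h ((tentMap lam hlam)^[n] y)|) (C := C) (fun n hn => ?_)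
        (Real.log |derivJ h y|) (EReal.coe_lt_coe_iff.1 hc)).mono fun n hn => ?_)
      · rw [← coe_tentMap_iterate hlam] at hn
        exact (abs_le.1 (hC _ hn)).1
      · rw [hlyap]
        exact EReal.coe_le_coe_iff.2 hn
    refine ⟨fun n => ?_, hinf, hlt, hsup, ?_⟩
    · obtain ⟨d, hd0, hd, -⟩ := hderiv n
      exact ⟨d, hd0, hd⟩
    · rintro ⟨χ, hχ⟩
      rw [hχ.liminf_eq] at hinf
      rw [hχ.limsup_eq] at hsup
      exact absurd (EReal.coe_le_coe_iff.1 (hsup.trans hinf)) (not_le.2 hlt)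
  · rintro ⟨_, ⟨n, rfl⟩, hsing⟩
    have hh0 : HasDerivJ h 0 zeroJ := hnf.crit
    -- a critical point of `f` is the turning point or a preimage of it
    have hhit : ∃ m, (tent lam)^[m] (y : ℝ) = 0 := by
      rcases hsing with hcrit | hturn
      · by_contra! hne
        have hyn : ∀ i, (tent lam)^[i] (((tentMap lam hlam)^[n] y : J) : ℝ) ≠ 0 := fun i => by
          rw [coe_tentMap_iterate, ← Function.iterate_add_apply]
          exact hne _
        obtain ⟨d, hd0, hd, -⟩ := hasDerivJ_iterate_conj hlam hf hh hyn 1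
        have hcrit' : HasDerivJ f 0 (h ((tentMap lam hlam)^[n] y)) := by
          rw [← hfit]; exact hcrit
        rw [Function.iterate_one] at hd
        exact hd0 (hd.derivJ_eq.symm.trans hcrit'.derivJ_eq)
      · exact ⟨n, (hit n).1 hturn⟩
    classical
    filter_upwards [eventually_gt_atTop (Nat.find hhit)] with n hn
    rintro ⟨d, hd⟩
    exact not_hasDerivJ_iterate_conj hlam hf hh hh0 H.ne_zero (Nat.find_spec hhit)
      (fun i hi => Nat.find_min hhit hi) hn d hd
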